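/- For complex $a,q$ with $|q|<1$ write $(a;q)_m=\prod_{j=0}^{m-1}(1-aq^j)$, $(a;q)_\infty=\prod_{j\ge 0}(1-aq^j)$ and $(a,b,c;q)_\infty=(a;q)_\infty(b;q)_\infty(c;q)_\infty$. Then for every complex $q$ with $|q|<1$ (and $q\neq 0$ in the third and fourth identities, where negative powers of $q$ are written) the following double series over integers $n,r\ge 0$ converge absolutely, with the stated sums: $$\sum_{n,r\ge 0}\frac{q^{n^2+2r^2+3nr+2n+3r}(q;q)_{n+r+1}}{(q;q)_{2n+2r+2}(q;q)_r(q;q)_n}=\frac{(q,q^{10},q^{11};q^{11})_\infty}{(q;q)_\infty},$$ $$\sum_{n,r\ge 0}\frac{q^{n^2+2r^2+3nr+2n+3r}(q;q)_{n+r+1}\,(1+q^{n+1}+q^n-q^{2n})}{(q;q)_{2n+2r+2}(q;q)_r(q;q)_n}=\frac{(q^2,q^9,q^{11};q^{11})_\infty}{(q;q)_\infty},$$ $$\sum_{n,r\ge 0}\frac{q^{n^2+2r^2+3nr}(q;q)_{n+r}\,\bigl[(q^{n-1}+q^n-q^{2n-1})-(q^{-1}+q^{n-2}+q^{n-1}-q^{2n-4})(1-q^{n-1})(1-q^n)\bigr]}{(q;q)_{2n+2r}(q;q)_r(q;q)_n}=\frac{(q^3,q^8,q^{11};q^{11})_\infty}{(q;q)_\infty},$$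 $$\sum_{n,r\ge 0}\frac{q^{n^2+2r^2+3nr}(q;q)_{n+r}\,(q^{n-1}+q^n-q^{2n-1})}{(q;q)_{2n+2r}(q;q)_r(q;q)_n}=\frac{(q^4,q^7,q^{11};q^{11})_\infty}{(q;q)_\infty},$$ $$\sum_{n,r\ge 0}\frac{q^{n^2+2r^2+3nr}(q;q)_{n+r}}{(q;q)_{2n+2r}(q;q)_r(q;q)_n}=\frac{(q^5,q^6,q^{11};q^{11})_\infty}{(q;q)_\infty}.$$ -/

import Mathlib

/-- The finite `q`-shifted factorial `(a; q)_m = ∏_{j=0}^{m-1} (1 - a q^j)`. -/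
noncomputable def qPoch (a q : ℂ) (m : ℕ) : ℂ :=
  ∏ j ∈ Finset.range m, (1 - a * q ^ j)

/-- The infinite `q`-shifted factorial `(a; q)_∞ = ∏_{j=0}^∞ (1 - a q^j)`. -/
noncomputable def qPochInf (a q : ℂ) : ℂ :=
  ∏' j : ℕ, (1 - a * q ^ j)

/-- `(a, b, c; q)_∞ = (a; q)_∞ (b; q)_∞ (c; q)_∞`. -/
noncomputable def qPochInf3 (a b c q : ℂ) : ℂ :=
  qPochInf a q * qPochInf b q * qPochInf c q

/-- For `|q| < 1` the infinite product defining `(a; q)_∞` converges (so `qPochInf` is never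
the default value of `∏'` there). -/
theorem qPochInf_hasProd (a q : ℂ) (hq : ‖q‖ < 1) :
    HasProd (fun j : ℕ => 1 - a * q ^ j) (qPochInf a q) := by
  have h : Summable fun j : ℕ => ‖-(a * q ^ j)‖ := by
    simp only [norm_neg, norm_mul, norm_pow]
    exact (summable_geometric_of_lt_one (norm_nonneg q) hq).mul_left _
  have h2 := multipliable_one_add_of_summable h
  simp only [← sub_eq_add_neg] at h2
  exact h2.hasProd

/-!
Write `Θ_k(a, b)` for the theta series of base `q ^ 3` at `q ^ k` whose `j`-th term is divided by
`(q; q)_{a-2j} (q; q)_{b+2j}`. Multiplying a term by `1 - q ^ (a - 2 j)` or `1 - q ^ (b + 2 j)`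
lowers `a` or `b` by one, and the symmetries `j ↦ -j`, `j ↦ 1 - j` of the theta series relate
different `k`. Because the base is `q ^ 3`, these relations close up into a recursion in `N` for
`Θ_2(N, N)` and `Θ_2(N - 1, N + 1)`, and the Rogers–Szegő polynomials at `(1, q ^ N)` and
`(q, q ^ N)` satisfy the same one. So each `Θ_k` needed is `(q; q)_N / (q; q)_{2N}` times a single
finite sum over `n + r = N`.

Multiplying by `q ^ N ^ 2` and summing over `N` gives the double series on that side. On the theta
side the weak Bailey lemma (a `q`-Chu–Vandermonde sum with its upper limit sent to infinity)
replaces the weights by the factor `q ^ (2 j) ^ 2 = q ^ (4 j ^ 2)`. It turns base `q ^ 3` into base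
`q ^ 11`, and the Jacobi triple product evaluates the result.
-/

open Filter Topology Finset

/-! ### The finite `q`-shifted factorial -/

theorem qPoch_zero (a q : ℂ) : qPoch a q 0 = 1 := by simp [qPoch]

theorem qPoch_succ (a q : ℂ) (m : ℕ) : qPoch a q (m + 1) = qPoch a q m * (1 - a * q ^ m) :=
  prod_range_succ _ _

theorem qPoch_succ' (a q : ℂ) (m : ℕ) : qPoch a q (m + 1) = (1 - a) * qPoch (q * a) q m := by
  simp only [qPoch, prod_range_succ', pow_zero, mul_one, mul_comm (1 - a), pow_succ', mul_assoc,
    mul_left_comm a]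

theorem qPoch_add (a q : ℂ) (m n : ℕ) :
    qPoch a q (m + n) = qPoch a q m * qPoch (a * q ^ m) q n := by
  simp only [qPoch, prod_range_add, pow_add, mul_assoc]

theorem qPoch_self_succ (q : ℂ) (m : ℕ) :
    qPoch q q (m + 1) = qPoch q q m * (1 - q ^ (m + 1)) := by
  rw [qPoch_succ, pow_succ']

theorem one_sub_pow_ne_zero {q : ℂ} (hq : ¬IsOfFinOrder q) {k : ℕ} (hk : k ≠ 0) :
    1 - q ^ k ≠ 0 := fun h =>
  hq <| isOfFinOrder_iff_pow_eq_one.mpr ⟨k, Nat.pos_of_ne_zero hk, (sub_eq_zero.mp h).symm⟩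

theorem qPoch_self_ne_zero {q : ℂ} (hq : ¬IsOfFinOrder q) (m : ℕ) : qPoch q q m ≠ 0 :=
  prod_ne_zero_iff.mpr fun j _ => by
    rw [← pow_succ']
    exact one_sub_pow_ne_zero hq j.add_one_ne_zero

/-- The reciprocal `1 / (q; q)_k`, extended by `0` to negative integers `k`. -/
noncomputable def qPochRecip (q : ℂ) : ℤ → ℂ
  | (k : ℕ) => (qPoch q q k)⁻¹
  | Int.negSucc _ => 0

theorem qPochRecip_natCast (q : ℂ) (k : ℕ) : qPochRecip q k = (qPoch q q k)⁻¹ := rfl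

theorem qPochRecip_zero (q : ℂ) : qPochRecip q 0 = 1 := by
  simpa [qPoch_zero] using qPochRecip_natCast q 0

theorem qPochRecip_of_neg (q : ℂ) {k : ℤ} (hk : k < 0) : qPochRecip q k = 0 := by
  obtain ⟨m, rfl⟩ := Int.eq_negSucc_of_lt_zero hk
  rfl

theorem qPochRecip_sub_one {q : ℂ} (hq : ¬IsOfFinOrder q) (k : ℤ) :
    qPochRecip q (k - 1) = (1 - q ^ k) * qPochRecip q k := by
  rcases lt_trichotomy k 0 with hk | rfl | hk
  · rw [qPochRecip_of_neg q hk, qPochRecip_of_neg q (by omega), mul_zero]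
  · rw [qPochRecip_of_neg q (by omega), zpow_zero, sub_self, zero_mul]
  · obtain ⟨m, rfl⟩ := Int.eq_succ_of_zero_lt hk
    have hm := one_sub_pow_ne_zero hq m.add_one_ne_zero
    rw [add_sub_cancel_right, ← Nat.cast_succ, qPochRecip_natCast, qPochRecip_natCast,
      zpow_natCast, qPoch_self_succ, mul_inv, mul_left_comm, mul_inv_cancel₀ hm, mul_one]

/-! ### Sums against the `q`-binomial coefficients -/

/-- The sum `∑_{k + l = M} f(k, l) / ((q; q)_k (q; q)_l)`, that is, `1 / (q; q)_M` times the sum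
of `f` against the `q`-binomial coefficients of order `M`. -/
noncomputable def qBinomSum (q : ℂ) (f : ℕ → ℕ → ℂ) (M : ℕ) : ℂ :=
  ∑ p ∈ antidiagonal M, f p.1 p.2 / (qPoch q q p.1 * qPoch q q p.2)

theorem qBinomSum_zero (q : ℂ) (f : ℕ → ℕ → ℂ) : qBinomSum q f 0 = f 0 0 := by
  simp [qBinomSum, qPoch_zero]

theorem qBinomSum_congr (q : ℂ) {f g : ℕ → ℕ → ℂ} {M : ℕ}
    (h : ∀ k l, k + l = M → f k l = g k l) : qBinomSum q f M = qBinomSum q g M :=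
  sum_congr rfl fun p hp => by rw [h p.1 p.2 (mem_antidiagonal.mp hp)]

theorem qBinomSum_add (q : ℂ) (f g : ℕ → ℕ → ℂ) (M : ℕ) :
    qBinomSum q (fun k l => f k l + g k l) M = qBinomSum q f M + qBinomSum q g M := by
  simp only [qBinomSum, add_div, sum_add_distrib]

theorem qBinomSum_sub (q : ℂ) (f g : ℕ → ℕ → ℂ) (M : ℕ) :
    qBinomSum q (fun k l => f k l - g k l) M = qBinomSum q f M - qBinomSum q g M := by
  simp only [qBinomSum, sub_div, sum_sub_distrib]

theorem qBinomSum_const_mul (q c : ℂ) (f : ℕ → ℕ → ℂ) (M : ℕ) :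
    qBinomSum q (fun k l => c * f k l) M = c * qBinomSum q f M := by
  simp only [qBinomSum, mul_div_assoc, mul_sum]

theorem qBinomSum_one_sub_pow_left {q : ℂ} (hq : ¬IsOfFinOrder q) (f : ℕ → ℕ → ℂ) (M : ℕ) :
    qBinomSum q (fun k l => (1 - q ^ k) * f k l) (M + 1) =
      qBinomSum q (fun k l => f (k + 1) l) M := by
  rw [qBinomSum, Nat.sum_antidiagonal_succ, pow_zero, sub_self, zero_mul, zero_div, zero_add]
  refine sum_congr rfl fun p _ => ?_
  rw [qPoch_self_succ, mul_comm (qPoch q q p.1), mul_assoc,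
    mul_div_mul_left _ _ (one_sub_pow_ne_zero hq p.1.add_one_ne_zero)]

theorem qBinomSum_one_sub_pow_right {q : ℂ} (hq : ¬IsOfFinOrder q) (f : ℕ → ℕ → ℂ) (M : ℕ) :
    qBinomSum q (fun k l => (1 - q ^ l) * f k l) (M + 1) =
      qBinomSum q (fun k l => f k (l + 1)) M := by
  rw [qBinomSum, Nat.sum_antidiagonal_succ', pow_zero, sub_self, zero_mul, zero_div, zero_add]
  refine sum_congr rfl fun p _ => ?_
  rw [qPoch_self_succ, ← mul_assoc, mul_comm _ (1 - _),
    mul_div_mul_left _ _ (one_sub_pow_ne_zero hq p.2.add_one_ne_zero)]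

-- The `q`-Pascal rule: `1 - q ^ (k + l) = (1 - q ^ k) + q ^ k * (1 - q ^ l)`.
theorem one_sub_pow_mul_qBinomSum_succ {q : ℂ} (hq : ¬IsOfFinOrder q) (f : ℕ → ℕ → ℂ) (M : ℕ) :
    (1 - q ^ (M + 1)) * qBinomSum q f (M + 1) =
      qBinomSum q (fun k l => f (k + 1) l + q ^ k * f k (l + 1)) M := by
  rw [qBinomSum_add, ← qBinomSum_one_sub_pow_left hq,
    ← qBinomSum_one_sub_pow_right hq fun k l => q ^ k * f k l, ← qBinomSum_add,
    ← qBinomSum_const_mul]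
  refine qBinomSum_congr q fun k l h => ?_
  rw [← h]
  ring

theorem qBinomSum_eq_sum_range (q : ℂ) (f : ℕ → ℕ → ℂ) (M : ℕ) :
    qBinomSum q f M =
      ∑ k ∈ range (M + 1), f k (M - k) * (qPochRecip q k * qPochRecip q (M - k)) := by
  rw [qBinomSum, Nat.sum_antidiagonal_eq_sum_range_succ_mk]
  refine sum_congr rfl fun k hk => ?_
  rw [← Nat.cast_sub (mem_range_succ_iff.mp hk), qPochRecip_natCast, qPochRecip_natCast, ← mul_inv,
    ← div_eq_mul_inv]

theorem hasSum_mul_qPochRecip (q : ℂ) (f : ℕ → ℂ) (M : ℕ) :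
    HasSum (fun k : ℕ => f k * (qPochRecip q k * qPochRecip q (M - k)))
      (qBinomSum q (fun k _ => f k) M) := by
  rw [qBinomSum_eq_sum_range]
  refine hasSum_sum_of_ne_finset_zero fun k hk => ?_
  rw [mem_range] at hk
  rw [qPochRecip_of_neg q (by omega : (M : ℤ) - k < 0), mul_zero, mul_zero]

theorem hasSum_int_mul_qPochRecip (q : ℂ) (f : ℤ → ℂ) (M : ℕ) :
    HasSum (fun k : ℤ => f k * (qPochRecip q k * qPochRecip q (M - k)))
      (qBinomSum q (fun k _ => f k) M) := by
  refine (Nat.cast_injective.hasSum_iff fun k hk => ?_).mp (hasSum_mul_qPochRecip q (f ·) M)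
  rw [qPochRecip_of_neg q (not_le.mp fun h => hk ⟨k.toNat, Int.toNat_of_nonneg h⟩), zero_mul,
    mul_zero]

/-! ### Two summation theorems -/

theorem qBinomSum_chu_vandermonde {q : ℂ} (hq : ¬IsOfFinOrder q) (M a : ℕ) :
    qBinomSum q (fun k _ => q ^ (k * (k + a)) / qPoch q q (k + a)) M =
      (qPoch q q M * qPoch q q (M + a))⁻¹ := by
  induction M generalizing a with
  | zero => simp [qBinomSum_zero, qPoch_zero]
  | succ M ih =>
    have hM := one_sub_pow_ne_zero hq M.add_one_ne_zero
    rw [← mul_right_inj' hM, one_sub_pow_mul_qBinomSum_succ hq, qPoch_self_succ,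
      mul_comm (qPoch q q M), mul_assoc, mul_inv, mul_inv_cancel_left₀ hM, add_assoc M,
      add_comm 1, ← ih]
    refine qBinomSum_congr q fun k l _ => ?_
    have hk := one_sub_pow_ne_zero hq (k + a).add_one_ne_zero
    have hka := qPoch_self_ne_zero hq (k + a)
    rw [add_right_comm, ← add_assoc, qPoch_self_succ]
    field_simp
    ring

/-- The general term `(-z)^j p^{j(j-1)/2}` of the theta series. -/
noncomputable def thetaTerm (p z : ℂ) (j : ℤ) : ℂ :=
  (-z) ^ j * p ^ (j * (j - 1) / 2)

theorem two_mul_mul_sub_one_ediv_two (j : ℤ) : 2 * (j * (j - 1) / 2) = j * (j - 1) :=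
  Int.mul_ediv_cancel' (Int.even_mul_pred_self j).two_dvd

theorem thetaTerm_zero (p z : ℂ) : thetaTerm p z 0 = 1 := by simp [thetaTerm]

theorem thetaTerm_one (p z : ℂ) : thetaTerm p z 1 = -z := by simp [thetaTerm]

theorem thetaTerm_mul (p t z : ℂ) (j : ℤ) : thetaTerm p (t * z) j = t ^ j * thetaTerm p z j := by
  rw [thetaTerm, thetaTerm, neg_mul_eq_mul_neg, mul_zpow, mul_assoc]

theorem thetaTerm_add {p z : ℂ} (hp : p ≠ 0) (hz : z ≠ 0) (i j : ℤ) :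
    thetaTerm p z (i + j) = thetaTerm p z i * thetaTerm p (p ^ i * z) j := by
  have hexp : (i + j) * (i + j - 1) / 2 = i * (i - 1) / 2 + j * (j - 1) / 2 + i * j := by
    have hi := two_mul_mul_sub_one_ediv_two i
    have hj := two_mul_mul_sub_one_ediv_two j
    have hij := two_mul_mul_sub_one_ediv_two (i + j)
    linarith
  rw [thetaTerm_mul, thetaTerm, thetaTerm, thetaTerm, hexp, zpow_add₀ (neg_ne_zero.mpr hz),
    zpow_add₀ hp, zpow_add₀ hp, zpow_mul]
  ring

theorem thetaTerm_neg {p : ℂ} (hp : p ≠ 0) (z : ℂ) (j : ℤ) :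
    thetaTerm p z (-j) = thetaTerm p (p / z) j := by
  have hexp : -j * (-j - 1) / 2 = j + j * (j - 1) / 2 := by
    have hj := two_mul_mul_sub_one_ediv_two j
    have hneg := two_mul_mul_sub_one_ediv_two (-j)
    linarith
  rw [div_eq_mul_inv, thetaTerm_mul, thetaTerm, thetaTerm, hexp, zpow_add₀ hp, zpow_neg,
    ← inv_zpow, inv_neg]
  ring

theorem qBinomSum_thetaTerm {q x : ℂ} (h0 : q ≠ 0) (hq : ¬IsOfFinOrder q) (hx : x ≠ 0) (M : ℕ) :
    qBinomSum q (fun k _ => thetaTerm q x k) M = qPoch x q M / qPoch q q M := by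
  induction M generalizing x with
  | zero => simp [qBinomSum_zero, qPoch_zero, thetaTerm_zero]
  | succ M ih =>
    have hM := one_sub_pow_ne_zero hq M.add_one_ne_zero
    have hterm (k : ℕ) : thetaTerm q x ↑(k + 1) + q ^ k * thetaTerm q x k =
        (1 - x) * thetaTerm q (q * x) k := by
      rw [Nat.cast_succ, add_comm (k : ℤ), thetaTerm_add h0 hx, thetaTerm_one, zpow_one,
        thetaTerm_mul, zpow_natCast]
      ring
    rw [← mul_right_inj' hM, one_sub_pow_mul_qBinomSum_succ hq]
    simp only [hterm]
    rw [qBinomSum_const_mul, ih (mul_ne_zero h0 hx), qPoch_self_succ, qPoch_succ']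
    field_simp

/-! ### Truncated theta series -/

/-- The theta series of base `p` with its `j`-th term divided by `(q; q)_{a-2j} (q; q)_{b+2j}`.
Only finitely many terms are nonzero, and the finite sides of the Rogers–Selberg type identities
modulo `11` are the case `p = q ^ 3`. -/
noncomputable def truncTheta (p q z : ℂ) (a b : ℤ) : ℂ :=
  ∑' j : ℤ, thetaTerm p z j * (qPochRecip q (a - 2 * j) * qPochRecip q (b + 2 * j))

theorem hasSum_truncTheta (p q z : ℂ) (a b : ℤ) :
    HasSum (fun j : ℤ => thetaTerm p z j * (qPochRecip q (a - 2 * j) * qPochRecip q (b + 2 * j)))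
      (truncTheta p q z a b) := by
  refine (summable_of_ne_finset_zero (s := Icc (-|b|) |a|) fun j hj => ?_).hasSum
  rcases lt_or_ge (a - 2 * j) 0 with ha | ha
  · rw [qPochRecip_of_neg q ha, zero_mul, mul_zero]
  · have hb : b + 2 * j < 0 := not_le.mp fun hb => hj <| mem_Icc.mpr
      ⟨by linarith [le_abs_self b, abs_nonneg b], by linarith [le_abs_self a, abs_nonneg a]⟩
    rw [qPochRecip_of_neg q hb, mul_zero, mul_zero]

theorem truncTheta_zero_zero (p z : ℂ) : truncTheta p q z 0 0 = 1 := by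
  have h := hasSum_single (f := fun j : ℤ => thetaTerm p z j *
    (qPochRecip q (0 - 2 * j) * qPochRecip q (0 + 2 * j))) 0 fun j hj => ?_
  · exact (hasSum_truncTheta p q z 0 0).unique (by simpa [thetaTerm_zero, qPochRecip_zero] using h)
  · rcases hj.lt_or_gt with hj | hj
    · rw [qPochRecip_of_neg q (by omega : 0 + 2 * j < 0), mul_zero, mul_zero]
    · rw [qPochRecip_of_neg q (by omega : 0 - 2 * j < 0), zero_mul, mul_zero]

theorem truncTheta_neg_one_one (p z : ℂ) : truncTheta p q z (-1) 1 = 0 := by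
  refine (hasSum_truncTheta p q z (-1) 1).unique (hasSum_zero.congr_fun fun j => ?_)
  rcases lt_or_ge j 0 with hj | hj
  · rw [qPochRecip_of_neg q (by omega : 1 + 2 * j < 0), mul_zero, mul_zero]
  · rw [qPochRecip_of_neg q (by omega : -1 - 2 * j < 0), zero_mul, mul_zero]

theorem truncTheta_comm {p : ℂ} (hp : p ≠ 0) (q z : ℂ) (a b : ℤ) :
    truncTheta p q z a b = truncTheta p q (p / z) b a := by
  rw [truncTheta, ← (Equiv.neg ℤ).tsum_eq]
  simp only [Equiv.neg_apply, thetaTerm_neg hp, mul_neg, sub_neg_eq_add, ← sub_eq_add_neg,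
    mul_comm (qPochRecip q (a + _)), truncTheta]

theorem truncTheta_shift {p z : ℂ} (hp : p ≠ 0) (hz : z ≠ 0) (q : ℂ) (a b : ℤ) :
    truncTheta p q z a b = -z * truncTheta p q (p * z) (a - 2) (b + 2) := by
  rw [truncTheta, ← (Equiv.addLeft (1 : ℤ)).tsum_eq, truncTheta, ← tsum_mul_left]
  simp only [Equiv.coe_addLeft, thetaTerm_add hp hz, thetaTerm_one, zpow_one, mul_add, mul_one,
    sub_add_eq_sub_sub, add_assoc, mul_assoc]

theorem truncTheta_sub_one_left {q : ℂ} (h0 : q ≠ 0) (hq : ¬IsOfFinOrder q) (p z : ℂ) (a b : ℤ) :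
    truncTheta p q (q ^ 2 * z) (a - 1) b =
      truncTheta p q (q ^ 2 * z) a b - q ^ a * truncTheta p q z a b := by
  refine (hasSum_truncTheta ..).unique (((hasSum_truncTheta ..).sub
    ((hasSum_truncTheta ..).mul_left _)).congr_fun fun j => ?_)
  rw [sub_right_comm, qPochRecip_sub_one hq, thetaTerm_mul, zpow_sub₀ h0, zpow_mul, zpow_ofNat]
  field_simp

theorem truncTheta_sub_one_right {q : ℂ} (h0 : q ≠ 0) (hq : ¬IsOfFinOrder q) (p z : ℂ)
    (a b : ℤ) :
    truncTheta p q z a (b - 1) =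
      truncTheta p q z a b - q ^ b * truncTheta p q (q ^ 2 * z) a b := by
  refine (hasSum_truncTheta ..).unique (((hasSum_truncTheta ..).sub
    ((hasSum_truncTheta ..).mul_left _)).congr_fun fun j => ?_)
  rw [sub_add_eq_add_sub, qPochRecip_sub_one hq, thetaTerm_mul, zpow_add₀ h0, zpow_mul, zpow_ofNat]
  ring

theorem truncTheta_antisymm {p z : ℂ} (hp : p ≠ 0) (hz : z ≠ 0) (q : ℂ) (n : ℤ) :
    truncTheta p q z (n - 1) (n + 1) =
      -(p / z) * truncTheta p q (p * (p / z)) (n - 1) (n + 1) := by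
  rw [truncTheta_comm hp, truncTheta_shift hp (div_ne_zero hp hz), show n + 1 - 2 = n - 1 by ring,
    show n - 1 + 2 = n + 1 by ring]

/-! ### The theta series of base `q ^ 3` -/

/-- The truncated theta series of base `q ^ 3` at `z = q ^ k`. -/
noncomputable def cubicTheta (q : ℂ) (k a b : ℤ) : ℂ :=
  truncTheta (q ^ 3) q (q ^ k) a b

section

variable {q : ℂ} (h0 : q ≠ 0) (hq : ¬IsOfFinOrder q)
include h0

theorem cubicTheta_comm (k a b : ℤ) : cubicTheta q k a b = cubicTheta q (3 - k) b a := by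
  rw [cubicTheta, cubicTheta, truncTheta_comm (pow_ne_zero 3 h0), zpow_sub₀ h0, zpow_ofNat]

theorem cubicTheta_antisymm (k n : ℤ) :
    cubicTheta q k (n - 1) (n + 1) = -q ^ (3 - k) * cubicTheta q (6 - k) (n - 1) (n + 1) := by
  rw [cubicTheta, cubicTheta, truncTheta_antisymm (pow_ne_zero 3 h0) (zpow_ne_zero k h0),
    zpow_sub₀ h0, zpow_sub₀ h0, zpow_ofNat, zpow_ofNat, ← mul_div_assoc, ← pow_add]

theorem cubicTheta_three_eq_zero (n : ℤ) : cubicTheta q 3 (n - 1) (n + 1) = 0 := by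
  have h := cubicTheta_antisymm h0 3 n
  norm_num at h
  exact self_eq_neg.mp h

include hq

theorem cubicTheta_sub_one_left (k a b : ℤ) :
    cubicTheta q (k + 2) (a - 1) b =
      cubicTheta q (k + 2) a b - q ^ a * cubicTheta q k a b := by
  rw [cubicTheta, cubicTheta, cubicTheta, zpow_add₀ h0, zpow_ofNat, mul_comm,
    truncTheta_sub_one_left h0 hq]

theorem cubicTheta_sub_one_right (k a b : ℤ) :
    cubicTheta q k a (b - 1) =
      cubicTheta q k a b - q ^ b * cubicTheta q (k + 2) a b := by
  rw [cubicTheta, cubicTheta, cubicTheta, zpow_add₀ h0, zpow_ofNat, mul_comm (q ^ k),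
    truncTheta_sub_one_right h0 hq]

-- The next five relations eliminate the values `cubicTheta q k a b` with `|a - b| = 1` from
-- instances of `cubicTheta_sub_one_left` and `cubicTheta_sub_one_right`.

theorem cubicTheta_two_sub_mul_three (n : ℤ) :
    cubicTheta q 2 n n - q ^ n * cubicTheta q 3 n n =
      (1 + q ^ n) * cubicTheta q 2 (n - 1) (n + 1) := by
  have hcomm : cubicTheta q 3 n n = cubicTheta q 0 n n := cubicTheta_comm h0 3 n n
  have hanti : q * cubicTheta q 4 (n - 1) (n + 1) = -cubicTheta q 2 (n - 1) (n + 1) := by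
    simpa [h0] using congrArg (q * ·) (cubicTheta_antisymm h0 4 n)
  have hleft : cubicTheta q 2 (n - 1) n = cubicTheta q 2 n n - q ^ n * cubicTheta q 0 n n :=
    cubicTheta_sub_one_left h0 hq 0 n n
  have hright : cubicTheta q 2 (n - 1) n =
      cubicTheta q 2 (n - 1) (n + 1) - q ^ n * (q * cubicTheta q 4 (n - 1) (n + 1)) := by
    simpa [zpow_add_one₀ h0, mul_assoc] using cubicTheta_sub_one_right h0 hq 2 (n - 1) (n + 1)
  rw [hcomm, ← hleft, hright, hanti]
  ring

theorem cubicTheta_three_sub_mul_two (n : ℤ) :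
    q * (cubicTheta q 3 n n - q ^ n * cubicTheta q 2 n n) =
      q ^ n * cubicTheta q 1 (n - 1) (n + 1) := by
  have hcomm : cubicTheta q 2 n n = cubicTheta q 1 n n := cubicTheta_comm h0 2 n n
  have hzero := cubicTheta_three_eq_zero h0 n
  have hanti : q ^ 2 * cubicTheta q 5 (n - 1) (n + 1) = -cubicTheta q 1 (n - 1) (n + 1) := by
    rw [cubicTheta_antisymm h0 5 n]
    simp [h0]
  have hleft : cubicTheta q 3 (n - 1) n = cubicTheta q 3 n n - q ^ n * cubicTheta q 1 n n :=
    cubicTheta_sub_one_left h0 hq 1 n n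
  have hright : cubicTheta q 3 (n - 1) n = -(q ^ n * q * cubicTheta q 5 (n - 1) (n + 1)) := by
    simpa [hzero, zpow_add_one₀ h0] using cubicTheta_sub_one_right h0 hq 3 (n - 1) (n + 1)
  rw [hcomm, ← hleft, hright]
  linear_combination -q ^ n * hanti

theorem cubicTheta_two_sub_mul_four (n : ℤ) :
    cubicTheta q 2 n n - q ^ n * cubicTheta q 4 n n = cubicTheta q 1 (n - 1) (n + 1) := by
  have hzero := cubicTheta_three_eq_zero h0 n
  have hright : cubicTheta q 2 n (n - 1) = cubicTheta q 2 n n - q ^ n * cubicTheta q 4 n n :=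
    cubicTheta_sub_one_right h0 hq 2 n n
  have hcomm : cubicTheta q 2 n (n - 1) = cubicTheta q 1 (n - 1) n := cubicTheta_comm h0 2 n (n - 1)
  rw [← hright, hcomm]
  simpa [hzero] using cubicTheta_sub_one_right h0 hq 1 (n - 1) (n + 1)

theorem one_sub_mul_cubicTheta_one (n : ℤ) :
    (1 - q * (q ^ n) ^ 2) * cubicTheta q 1 n (n + 2) = cubicTheta q 2 n n := by
  have hcomm : cubicTheta q 2 n n = cubicTheta q 1 n n := cubicTheta_comm h0 2 n n
  have hzero := cubicTheta_three_eq_zero h0 n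
  have hzero' : cubicTheta q 3 n (n + 2) = 0 := by
    simpa [add_assoc] using cubicTheta_three_eq_zero h0 (n + 1)
  have hone : cubicTheta q 1 n (n + 1) = cubicTheta q 1 n (n + 2) := by
    simpa [hzero', add_sub_assoc] using cubicTheta_sub_one_right h0 hq 1 n (n + 2)
  have hleft : cubicTheta q 3 (n - 1) (n + 1) =
      cubicTheta q 3 n (n + 1) - q ^ n * cubicTheta q 1 n (n + 1) :=
    cubicTheta_sub_one_left h0 hq 1 n (n + 1)
  have hright : cubicTheta q 1 n n =
      cubicTheta q 1 n (n + 1) - q ^ n * q * cubicTheta q 3 n (n + 1) := by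
    simpa [zpow_add_one₀ h0] using cubicTheta_sub_one_right h0 hq 1 n (n + 1)
  rw [hcomm, hright, ← hone]
  linear_combination q ^ n * q * (hzero - hleft)

theorem one_sub_mul_cubicTheta_two (n : ℤ) :
    (1 - q * (q ^ n) ^ 2) * (1 + q * q ^ n) * cubicTheta q 2 n (n + 2) =
      cubicTheta q 2 (n - 1) (n + 1) + q ^ n * cubicTheta q 3 n n := by
  have hcomm : cubicTheta q 3 n n = cubicTheta q 0 n n := cubicTheta_comm h0 3 n n
  have hanti : q * cubicTheta q 4 n (n + 2) = -cubicTheta q 2 n (n + 2) := by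
    simpa [h0, add_assoc] using congrArg (q * ·) (cubicTheta_antisymm h0 4 (n + 1))
  have htwo : cubicTheta q 2 n (n + 1) =
      cubicTheta q 2 n (n + 2) - q * q ^ n * (q * cubicTheta q 4 n (n + 2)) := by
    have h := cubicTheta_sub_one_right h0 hq 2 n (n + 2)
    rw [show n + 2 - 1 = n + 1 by ring, show (2 : ℤ) + 2 = 4 by rfl, zpow_add₀ h0, zpow_ofNat] at h
    linear_combination h
  have hleft : cubicTheta q 2 (n - 1) (n + 1) =
      cubicTheta q 2 n (n + 1) - q ^ n * cubicTheta q 0 n (n + 1) :=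
    cubicTheta_sub_one_left h0 hq 0 n (n + 1)
  have hright : cubicTheta q 0 n n =
      cubicTheta q 0 n (n + 1) - q ^ n * q * cubicTheta q 2 n (n + 1) := by
    simpa [zpow_add_one₀ h0] using cubicTheta_sub_one_right h0 hq 0 n (n + 1)
  rw [hcomm, hleft, hright, htwo, hanti]
  ring

theorem one_sub_mul_cubicTheta_two_eq_sub (n : ℤ) :
    (1 - q * (q ^ n) ^ 2) * (1 + q * q ^ n) * cubicTheta q 2 n (n + 2) =
      cubicTheta q 2 n n - q ^ n * cubicTheta q 2 (n - 1) (n + 1) := by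
  linear_combination one_sub_mul_cubicTheta_two h0 hq n - cubicTheta_two_sub_mul_three h0 hq n

theorem one_sub_mul_cubicTheta_two_succ (n : ℤ) :
    (1 - q ^ 2 * (q ^ n) ^ 2) * (1 - q * (q ^ n) ^ 2) * cubicTheta q 2 (n + 1) (n + 1) =
      (1 + q * (q ^ n) ^ 2) * cubicTheta q 2 n n - q ^ n * cubicTheta q 2 (n - 1) (n + 1) := by
  have htwo := cubicTheta_two_sub_mul_three h0 hq (n + 1)
  have hthree := cubicTheta_three_sub_mul_two h0 hq (n + 1)
  have hone := one_sub_mul_cubicTheta_one h0 hq n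
  have hodd := one_sub_mul_cubicTheta_two_eq_sub h0 hq n
  rw [add_sub_cancel_right, add_assoc, one_add_one_eq_two, zpow_add_one₀ h0] at htwo hthree
  linear_combination (1 - q * (q ^ n) ^ 2) * (htwo + q ^ n * hthree) + hodd
    + q * (q ^ n) ^ 2 * hone

end

/-! ### Rogers–Szegő polynomials -/

/-- The homogeneous Rogers–Szegő polynomial `∑_{k + l = N} x^k y^l / ((q; q)_k (q; q)_l)`,
normalised by the factor `1 / (q; q)_N`. -/
noncomputable def rogersSzego (q x y : ℂ) (N : ℕ) : ℂ :=
  qBinomSum q (fun k l => x ^ k * y ^ l) N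

theorem rogersSzego_zero (q x y : ℂ) : rogersSzego q x y 0 = 1 := by
  simp [rogersSzego, qBinomSum_zero]

theorem rogersSzego_mul_mul (q t x y : ℂ) (N : ℕ) :
    rogersSzego q (t * x) (t * y) N = t ^ N * rogersSzego q x y N := by
  rw [rogersSzego, rogersSzego, ← qBinomSum_const_mul]
  refine qBinomSum_congr q fun k l h => ?_
  rw [← h]
  ring

section

variable {q : ℂ} (hq : ¬IsOfFinOrder q)
include hq

theorem rogersSzego_succ_sub_left (x y : ℂ) (N : ℕ) :
    rogersSzego q x y (N + 1) - rogersSzego q (q * x) y (N + 1) = x * rogersSzego q x y N := by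
  simp only [rogersSzego]
  rw [← qBinomSum_sub, ← qBinomSum_const_mul]
  refine (qBinomSum_congr q fun k l _ => ?_).trans
    ((qBinomSum_one_sub_pow_left hq (fun k l => x ^ k * y ^ l) N).trans
      (qBinomSum_congr q fun k l _ => ?_)) <;> ring

theorem rogersSzego_succ_sub_right (x y : ℂ) (N : ℕ) :
    rogersSzego q x y (N + 1) - rogersSzego q x (q * y) (N + 1) = y * rogersSzego q x y N := by
  simp only [rogersSzego]
  rw [← qBinomSum_sub, ← qBinomSum_const_mul]
  refine (qBinomSum_congr q fun k l _ => ?_).trans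
    ((qBinomSum_one_sub_pow_right hq (fun k l => x ^ k * y ^ l) N).trans
      (qBinomSum_congr q fun k l _ => ?_)) <;> ring

theorem rogersSzego_three_term (x y : ℂ) (N : ℕ) :
    x * (rogersSzego q x y N - rogersSzego q x (q * y) N) =
      y * (rogersSzego q x y N - rogersSzego q (q * x) y N) := by
  cases N with
  | zero => simp [rogersSzego_zero]
  | succ N =>
    rw [rogersSzego_succ_sub_left hq, rogersSzego_succ_sub_right hq]
    ring

theorem rogersSzego_pow_three_term (k N : ℕ) :
    q ^ (k + 1) *
        (rogersSzego q (q ^ (k + 1)) (q ^ N) N - q ^ N * rogersSzego q (q ^ k) (q ^ N) N) =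
      q ^ N *
        (rogersSzego q (q ^ (k + 1)) (q ^ N) N - rogersSzego q (q ^ (k + 2)) (q ^ N) N) := by
  rw [← rogersSzego_mul_mul, ← pow_succ', rogersSzego_three_term hq, ← pow_succ']

theorem rogersSzego_one_pow_succ (N : ℕ) :
    rogersSzego q 1 (q ^ (N + 1)) N = rogersSzego q 1 (q ^ N) N -
      q ^ N * (rogersSzego q 1 (q ^ N) N - rogersSzego q q (q ^ N) N) := by
  have h := rogersSzego_three_term hq 1 (q ^ N) N
  rw [mul_one, ← pow_succ'] at h
  linear_combination -h

theorem one_sub_mul_rogersSzego_succ (N : ℕ) :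
    (1 - q ^ (N + 1)) * rogersSzego q 1 (q ^ (N + 1)) (N + 1) =
      (1 + q * (q ^ N) ^ 2) * rogersSzego q 1 (q ^ N) N -
        q ^ N * (rogersSzego q 1 (q ^ N) N - rogersSzego q q (q ^ N) N) := by
  have hleft := rogersSzego_succ_sub_left hq 1 (q ^ (N + 1)) N
  have hright := rogersSzego_succ_sub_right hq 1 (q ^ N) N
  have hscale := rogersSzego_mul_mul q q 1 (q ^ N) (N + 1)
  rw [← pow_succ'] at hright hscale
  rw [mul_one] at hleft hscale
  linear_combination hleft + hscale + q ^ (N + 1) * hright + rogersSzego_one_pow_succ hq N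

/-! ### The truncated theta series as Rogers–Szegő polynomials -/

theorem qPoch_div_qPoch_double_succ (N : ℕ) :
    (1 - q * (q ^ N) ^ 2) * (1 + q ^ (N + 1)) *
        (qPoch q q (N + 1) / qPoch q q (2 * (N + 1))) =
      qPoch q q N / qPoch q q (2 * N) := by
  have hN := qPoch_self_ne_zero hq (2 * N)
  have hodd := one_sub_pow_ne_zero hq (2 * N).add_one_ne_zero
  have heven := one_sub_pow_ne_zero hq (2 * N + 1).add_one_ne_zero
  rw [Nat.mul_succ, qPoch_self_succ q N, qPoch_self_succ, qPoch_self_succ]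
  field_simp
  ring

theorem cubicTheta_two_eq_rogersSzego (h0 : q ≠ 0) (N : ℕ) :
    cubicTheta q 2 N N = qPoch q q N / qPoch q q (2 * N) * rogersSzego q 1 (q ^ N) N ∧
      cubicTheta q 2 (N - 1) (N + 1) = qPoch q q N / qPoch q q (2 * N) *
        (rogersSzego q 1 (q ^ N) N - rogersSzego q q (q ^ N) N) := by
  induction N with
  | zero =>
    simp [cubicTheta, truncTheta_zero_zero, truncTheta_neg_one_one, rogersSzego_zero, qPoch_zero]
  | succ N ih =>
    have hodd : 1 - q * (q ^ N) ^ 2 ≠ 0 := by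
      simpa [pow_succ', pow_mul'] using one_sub_pow_ne_zero hq (2 * N).add_one_ne_zero
    have hsucc := one_sub_pow_ne_zero hq N.add_one_ne_zero
    have heven : 1 + q ^ (N + 1) ≠ 0 := by
      refine right_ne_zero_of_mul (a := 1 - q ^ (N + 1)) ?_
      convert one_sub_pow_ne_zero hq (2 * N + 1).add_one_ne_zero using 1
      ring
    have hbalanced := one_sub_mul_cubicTheta_two_succ h0 hq N
    have hskew := one_sub_mul_cubicTheta_two_eq_sub h0 hq N
    rw [zpow_natCast, ih.1, ih.2] at hbalanced hskew
    have hc := qPoch_div_qPoch_double_succ hq N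
    have hleft := rogersSzego_succ_sub_left hq 1 (q ^ (N + 1)) N
    rw [mul_one, one_mul] at hleft
    push_cast
    rw [add_sub_cancel_right, add_assoc (N : ℤ), one_add_one_eq_two]
    constructor
    · rw [← mul_right_inj' (mul_ne_zero (mul_ne_zero hsucc heven) hodd)]
      linear_combination hbalanced
        - qPoch q q N / qPoch q q (2 * N) * one_sub_mul_rogersSzego_succ hq N
        - (1 - q ^ (N + 1)) * rogersSzego q 1 (q ^ (N + 1)) (N + 1) * hc
    · rw [hleft, rogersSzego_one_pow_succ hq, ← mul_right_inj' (mul_ne_zero hodd heven)]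
      linear_combination hskew - (rogersSzego q 1 (q ^ N) N -
        q ^ N * (rogersSzego q 1 (q ^ N) N - rogersSzego q q (q ^ N) N)) * hc

theorem cubicTheta_two_skew_eq (h0 : q ≠ 0) (N : ℕ) :
    cubicTheta q 2 N (N + 2) = qPoch q q (N + 1) / qPoch q q (2 * (N + 1)) *
      rogersSzego q 1 (q ^ (N + 1)) N := by
  have h := (cubicTheta_two_eq_rogersSzego hq h0 (N + 1)).2
  have hleft := rogersSzego_succ_sub_left hq 1 (q ^ (N + 1)) N
  rw [mul_one, one_mul] at hleft
  rwa [Nat.cast_succ, add_sub_cancel_right, add_assoc, one_add_one_eq_two, hleft] at h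

theorem cubicTheta_one_skew_eq (h0 : q ≠ 0) (N : ℕ) :
    cubicTheta q 1 N (N + 2) = qPoch q q (N + 1) / qPoch q q (2 * (N + 1)) *
      qBinomSum q (fun n r => (1 + q * q ^ n + q ^ n - (q ^ n) ^ 2) * (q ^ (N + 1)) ^ r) N := by
  have hodd : 1 - q * (q ^ N) ^ 2 ≠ 0 := by
    simpa [pow_succ', pow_mul'] using one_sub_pow_ne_zero hq (2 * N).add_one_ne_zero
  have hexpand : qBinomSum q
      (fun n r => (1 + q * q ^ n + q ^ n - (q ^ n) ^ 2) * (q ^ (N + 1)) ^ r) N =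
      rogersSzego q 1 (q ^ (N + 1)) N + (1 + q) * rogersSzego q q (q ^ (N + 1)) N -
        rogersSzego q (q * q) (q ^ (N + 1)) N := by
    simp only [rogersSzego, ← qBinomSum_const_mul, ← qBinomSum_add, ← qBinomSum_sub]
    exact qBinomSum_congr q fun n r _ => by ring
  have hone := rogersSzego_mul_mul q q 1 (q ^ N) N
  have htwo := rogersSzego_mul_mul q q q (q ^ N) N
  have hbalanced := one_sub_mul_cubicTheta_one h0 hq N
  rw [mul_one, ← pow_succ'] at hone
  rw [← pow_succ'] at htwo
  rw [zpow_natCast, (cubicTheta_two_eq_rogersSzego hq h0 N).1] at hbalanced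
  rw [hexpand, hone, htwo, rogersSzego_one_pow_succ hq, ← mul_right_inj' hodd, hbalanced]
  linear_combination -rogersSzego q 1 (q ^ N) N * qPoch_div_qPoch_double_succ hq N

theorem mul_cubicTheta_three_eq_rogersSzego (h0 : q ≠ 0) (N : ℕ) :
    q * cubicTheta q 3 N N = qPoch q q N / qPoch q q (2 * N) *
      ((1 + q) * rogersSzego q (q ^ 1) (q ^ N) N - rogersSzego q (q ^ 2) (q ^ N) N) := by
  obtain ⟨hbalanced, hskew⟩ := cubicTheta_two_eq_rogersSzego hq h0 N
  have hrel := cubicTheta_two_sub_mul_three h0 hq N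
  have hzero := rogersSzego_pow_three_term hq 0 N
  simp only [zero_add, pow_zero, pow_one] at hzero ⊢
  rw [zpow_natCast, hbalanced, hskew] at hrel
  rw [← mul_right_inj' (pow_ne_zero N h0)]
  linear_combination -q * hrel + qPoch q q N / qPoch q q (2 * N) * hzero

theorem pow_mul_cubicTheta_four_eq_rogersSzego (h0 : q ≠ 0) (N : ℕ) :
    q ^ 5 * cubicTheta q 4 N N = qPoch q q N / qPoch q q (2 * N) *
      (rogersSzego q (q ^ 4) (q ^ N) N
        - (1 + q + q ^ 2 + q ^ 3) * rogersSzego q (q ^ 3) (q ^ N) N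
        + (q + q ^ 2 + q ^ 3) * rogersSzego q (q ^ 2) (q ^ N) N
        + (q ^ 4 + q ^ 5) * rogersSzego q (q ^ 1) (q ^ N) N
        - q ^ 4 * rogersSzego q (q ^ 0) (q ^ N) N) := by
  have htwo := (cubicTheta_two_eq_rogersSzego hq h0 N).1
  have hthree := mul_cubicTheta_three_eq_rogersSzego hq h0 N
  have hrel₃ := cubicTheta_three_sub_mul_two h0 hq N
  have hrel₄ := cubicTheta_two_sub_mul_four h0 hq N
  have hterm₀ := rogersSzego_pow_three_term hq 0 N
  have hterm₁ := rogersSzego_pow_three_term hq 1 N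
  have hterm₂ := rogersSzego_pow_three_term hq 2 N
  rw [zpow_natCast] at hrel₃ hrel₄
  rw [← pow_zero q] at htwo
  rw [← mul_right_inj' (pow_ne_zero 2 (pow_ne_zero N h0))]
  linear_combination q ^ 5 * hrel₃ - q ^ 5 * q ^ N * hrel₄ + q ^ 5 * (1 + q) * q ^ N * htwo
    - q ^ 5 * hthree + qPoch q q N / qPoch q q (2 * N) *
      ((q ^ 3 + (q + q ^ 2 + q ^ 3) * q ^ N) * hterm₁ - q ^ N * hterm₂
        - (q ^ 4 + q ^ 5 + q ^ 3 * q ^ N) * hterm₀)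

theorem cubicTheta_three_eq (h0 : q ≠ 0) (N : ℕ) :
    cubicTheta q 3 N N = qPoch q q N / qPoch q q (2 * N) *
      qBinomSum q (fun n r => (q ^ n / q + q ^ n - (q ^ n) ^ 2 / q) * (q ^ N) ^ r) N := by
  rw [← mul_right_inj' h0, mul_cubicTheta_three_eq_rogersSzego hq h0, mul_left_comm q]
  congr 1
  simp only [rogersSzego, ← qBinomSum_const_mul, ← qBinomSum_sub]
  refine qBinomSum_congr q fun n r _ => ?_
  field_simp
  ring

theorem cubicTheta_four_eq (h0 : q ≠ 0) (N : ℕ) :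
    cubicTheta q 4 N N = qPoch q q N / qPoch q q (2 * N) *
      qBinomSum q (fun n r => ((q ^ n / q + q ^ n - (q ^ n) ^ 2 / q) -
        (q⁻¹ + q ^ n / q ^ 2 + q ^ n / q - (q ^ n) ^ 2 / q ^ 4) * (1 - q ^ n / q) *
          (1 - q ^ n)) * (q ^ N) ^ r) N := by
  rw [← mul_right_inj' (pow_ne_zero 5 h0), pow_mul_cubicTheta_four_eq_rogersSzego hq h0,
    mul_left_comm (q ^ 5)]
  congr 1
  simp only [rogersSzego, ← qBinomSum_const_mul, ← qBinomSum_add, ← qBinomSum_sub]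
  refine qBinomSum_congr q fun n r _ => ?_
  field_simp
  ring

end

/-! ### Limits and the Jacobi triple product -/

theorem not_isOfFinOrder_of_norm_lt_one {q : ℂ} (hq : ‖q‖ < 1) : ¬IsOfFinOrder q :=
  fun h => hq.ne h.norm_eq_one

theorem tendsto_qPoch {q : ℂ} (hq : ‖q‖ < 1) (a : ℂ) :
    Tendsto (qPoch a q) atTop (𝓝 (qPochInf a q)) :=
  (qPochInf_hasProd a q hq).tendsto_prod_nat

theorem exists_norm_qPoch_le {q : ℂ} (hq : ‖q‖ < 1) (a : ℂ) : ∃ C, ∀ m, ‖qPoch a q m‖ ≤ C := by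
  obtain ⟨C, hC⟩ := (Metric.isBounded_range_of_tendsto _ (tendsto_qPoch hq a)).exists_norm_le
  exact ⟨C, fun m => hC _ ⟨m, rfl⟩⟩

theorem qPochInf_self_ne_zero {q : ℂ} (hq : ‖q‖ < 1) : qPochInf q q ≠ 0 := by
  have hsum : Summable fun j : ℕ => ‖-(q * q ^ j)‖ := by
    simp only [norm_neg, norm_mul, norm_pow]
    exact (summable_geometric_of_lt_one (norm_nonneg q) hq).mul_left _
  have hfactor (j : ℕ) : 1 + -(q * q ^ j) ≠ 0 := by
    rw [← sub_eq_add_neg, ← pow_succ']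
    exact one_sub_pow_ne_zero (not_isOfFinOrder_of_norm_lt_one hq) j.add_one_ne_zero
  have hprod := tprod_one_add_ne_zero_of_summable hfactor hsum
  simp only [← sub_eq_add_neg] at hprod
  exact hprod

theorem tendsto_qPochRecip_add {q : ℂ} (hq : ‖q‖ < 1) (m : ℤ) :
    Tendsto (fun N : ℕ => qPochRecip q (N + m)) atTop (𝓝 (qPochInf q q)⁻¹) := by
  have hshift : Tendsto (fun N : ℕ => (N + m).toNat) atTop atTop :=
    tendsto_atTop_atTop.mpr fun b => ⟨b + m.natAbs, fun N hN => by omega⟩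
  refine (((tendsto_qPoch hq q).inv₀ (qPochInf_self_ne_zero hq)).comp hshift).congr' ?_
  filter_upwards [eventually_ge_atTop m.natAbs] with N hN
  rw [Function.comp_apply, ← qPochRecip_natCast, Int.toNat_of_nonneg (by omega)]

theorem exists_norm_qPochRecip_le {q : ℂ} (hq : ‖q‖ < 1) :
    ∃ C, ∀ k : ℤ, ‖qPochRecip q k‖ ≤ C := by
  obtain ⟨C, hC⟩ := (Metric.isBounded_range_of_tendsto _
    (tendsto_qPochRecip_add hq 0)).exists_norm_le
  simp only [add_zero] at hC
  refine ⟨C, fun k => ?_⟩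
  rcases lt_or_ge k 0 with hk | hk
  · rw [qPochRecip_of_neg q hk, norm_zero]
    exact (norm_nonneg _).trans (hC _ (Set.mem_range_self 0))
  · lift k to ℕ using hk
    exact hC _ (Set.mem_range_self k)

theorem hasSum_durfee {q : ℂ} (hq : ‖q‖ < 1) (a : ℕ) :
    HasSum (fun k : ℕ => q ^ (k * (k + a)) * (qPochRecip q (k + a : ℕ) * qPochRecip q k))
      (qPochInf q q)⁻¹ := by
  obtain ⟨C, hC⟩ := exists_norm_qPochRecip_le hq
  have hC0 : 0 ≤ C := (norm_nonneg _).trans (hC 0)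
  have hpow (k : ℕ) : ‖q‖ ^ (k * (k + a)) ≤ ‖q‖ ^ k :=
    pow_le_pow_of_le_one (norm_nonneg q) hq.le (by nlinarith [Nat.le_mul_self k])
  have hgeom := summable_geometric_of_lt_one (norm_nonneg q) hq
  have hfinite (M : ℕ) : ∑' k : ℕ, q ^ (k * (k + a)) * (qPochRecip q (k + a : ℕ) *
      qPochRecip q k) * qPochRecip q (M + -k) = qPochRecip q (M + 0) * qPochRecip q (M + a) := by
    rw [add_zero, ← Nat.cast_add, qPochRecip_natCast, qPochRecip_natCast, ← mul_inv,
      ← qBinomSum_chu_vandermonde (not_isOfFinOrder_of_norm_lt_one hq)]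
    refine ((hasSum_mul_qPochRecip q _ M).congr_fun fun k => ?_).tsum_eq
    rw [qPochRecip_natCast q (k + a), ← sub_eq_add_neg]
    ring
  have hlim := tendsto_tsum_of_dominated_convergence (hgeom.mul_right (C * C * C))
    (fun k => (tendsto_qPochRecip_add hq (-k)).const_mul
      (q ^ (k * (k + a)) * (qPochRecip q (k + a : ℕ) * qPochRecip q k)))
    (.of_forall fun M k => by
      rw [norm_mul, norm_mul, norm_mul, norm_pow, mul_assoc (_ ^ _)]
      exact mul_le_mul (hpow k) (mul_le_mul (mul_le_mul (hC _) (hC _) (norm_nonneg _) hC0) (hC _)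
        (norm_nonneg _) (by positivity)) (by positivity) (by positivity))
  have hlim' := (tendsto_qPochRecip_add hq 0).mul (tendsto_qPochRecip_add hq a)
  have heq := tendsto_nhds_unique (hlim.congr hfinite) hlim'
  rw [tsum_mul_right] at heq
  rw [← mul_right_cancel₀ (inv_ne_zero (qPochInf_self_ne_zero hq)) heq]
  refine (Summable.of_norm_bounded (hgeom.mul_right (C * C)) fun k => ?_).hasSum
  rw [norm_mul, norm_mul, norm_pow]
  exact mul_le_mul (hpow k) (mul_le_mul (hC _) (hC _) (norm_nonneg _) hC0) (by positivity)
    (by positivity)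

theorem hasSum_pow_sq_mul_qPochRecip {q : ℂ} (hq : ‖q‖ < 1) (m : ℤ) :
    HasSum (fun N : ℕ => q ^ N ^ 2 * (qPochRecip q (N - m) * qPochRecip q (N + m)))
      (q ^ m ^ 2 * (qPochInf q q)⁻¹) := by
  wlog hm : 0 ≤ m generalizing m
  · have h := this (-m) (by omega)
    rw [even_two.neg_pow] at h
    refine h.congr_fun fun N => ?_
    rw [sub_neg_eq_add, ← sub_eq_add_neg, mul_comm (qPochRecip q (N + m))]
  lift m to ℕ using hm
  rw [← (add_left_injective m).hasSum_iff]
  · refine ((hasSum_durfee hq (2 * m)).mul_left (q ^ (m : ℤ) ^ 2)).congr_fun fun k => ?_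
    have hcast : ((k + m : ℕ) : ℤ) + m = (k + 2 * m : ℕ) := by push_cast; ring
    rw [Function.comp_apply, hcast, Nat.cast_add, add_sub_cancel_right, ← Nat.cast_pow,
      zpow_natCast]
    ring
  · intro N hN
    have hlt : N < m := not_le.mp fun h => hN ⟨N - m, Nat.sub_add_cancel h⟩
    rw [qPochRecip_of_neg q (by omega : (N : ℤ) - m < 0), zero_mul, mul_zero]

theorem summable_thetaTerm {p z : ℂ} (hp : p ≠ 0) (hp' : ‖p‖ < 1) (hz : z ≠ 0) :
    Summable (thetaTerm p z) := by
  have hnat {z : ℂ} (hz : z ≠ 0) : Summable fun n : ℕ => thetaTerm p z n := by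
    have hne (n : ℕ) : thetaTerm p z n ≠ 0 :=
      mul_ne_zero (zpow_ne_zero _ (neg_ne_zero.mpr hz)) (zpow_ne_zero _ hp)
    refine summable_of_ratio_test_tendsto_lt_one zero_lt_one (.of_forall hne) ?_
    have hratio (n : ℕ) : ‖thetaTerm p z ↑(n + 1)‖ / ‖thetaTerm p z n‖ = ‖p‖ ^ n * ‖z‖ := by
      rw [Nat.cast_succ, thetaTerm_add hp hz, thetaTerm_one, norm_mul, mul_div_cancel_left₀,
        norm_neg, zpow_natCast, norm_mul, norm_pow]
      exact norm_ne_zero_iff.mpr (hne n)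
    simp only [hratio]
    simpa using (tendsto_pow_atTop_nhds_zero_of_lt_one (norm_nonneg p) hp').mul_const ‖z‖
  refine Summable.of_nat_of_neg (hnat hz) ?_
  simpa only [thetaTerm_neg hp] using hnat (div_ne_zero hp hz)

theorem qPoch_div_pow {q z : ℂ} (h0 : q ≠ 0) (hz : z ≠ 0) (N : ℕ) :
    qPoch (z / q ^ N) q N = thetaTerm q (z / q ^ N) N * qPoch (q / z) q N := by
  induction N with
  | zero => simp [qPoch_zero, thetaTerm_zero]
  | succ N ih =>
    have hx : z / q ^ (N + 1) ≠ 0 := div_ne_zero hz (pow_ne_zero _ h0)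
    have hstep : q * (z / q ^ (N + 1)) = z / q ^ N := by
      field_simp
      ring
    rw [qPoch_succ', hstep, ih, qPoch_succ, Nat.cast_succ, add_comm (N : ℤ), thetaTerm_add h0 hx,
      thetaTerm_one, zpow_one, hstep]
    field_simp
    ring

theorem hasSum_finite_triple_product {q z : ℂ} (h0 : q ≠ 0) (hq : ¬IsOfFinOrder q) (hz : z ≠ 0)
    (N : ℕ) :
    HasSum (fun j : ℤ => thetaTerm q z j * (qPochRecip q (N + j) * qPochRecip q (N - j)))
      (qPoch (q / z) q N * qPoch z q N / qPoch q q (2 * N)) := by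
  have hqN : q ^ N ≠ 0 := pow_ne_zero N h0
  have hx : z / q ^ N ≠ 0 := div_ne_zero hz hqN
  have hlead : thetaTerm q (z / q ^ N) N ≠ 0 :=
    mul_ne_zero (zpow_ne_zero _ (neg_ne_zero.mpr hx)) (zpow_ne_zero _ h0)
  have h := hasSum_int_mul_qPochRecip q (thetaTerm q (z / q ^ N)) (2 * N)
  rw [qBinomSum_thetaTerm h0 hq hx, two_mul N, qPoch_add, qPoch_div_pow h0 hz,
    div_mul_cancel₀ z hqN, mul_assoc, mul_div_assoc, ← (Equiv.addLeft (N : ℤ)).hasSum_iff,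
    ← two_mul] at h
  rw [← hasSum_mul_left_iff hlead]
  refine h.congr_fun fun j => ?_
  simp only [Function.comp_apply, Equiv.coe_addLeft, thetaTerm_add h0 hx, zpow_natCast,
    mul_div_cancel₀ z hqN, mul_assoc, two_mul, Nat.cast_add, add_sub_add_left_eq_sub]

theorem hasSum_jacobi_triple_product {q z : ℂ} (h0 : q ≠ 0) (hq : ‖q‖ < 1) (hz : z ≠ 0) :
    HasSum (thetaTerm q z) (qPochInf3 (q / z) z q q) := by
  obtain ⟨C, hC⟩ := exists_norm_qPochRecip_le hq
  have hC0 : 0 ≤ C := (norm_nonneg _).trans (hC 0)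
  have hne := qPochInf_self_ne_zero hq
  have hsum := summable_thetaTerm h0 hq hz
  have hlim := tendsto_tsum_of_dominated_convergence (hsum.norm.mul_right (C * C))
    (fun j => ((tendsto_qPochRecip_add hq j).mul (tendsto_qPochRecip_add hq (-j))).const_mul
      (thetaTerm q z j))
    (.of_forall fun N j => by
      rw [norm_mul, norm_mul]
      gcongr
      exacts [hC _, hC _])
  have hlim' := ((tendsto_qPoch hq (q / z)).mul (tendsto_qPoch hq z)).div
    ((tendsto_qPoch hq q).comp (tendsto_id.const_mul_atTop' two_pos)) hne
  have heq := tendsto_nhds_unique (hlim.congr fun N =>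
    (hasSum_finite_triple_product h0 (not_isOfFinOrder_of_norm_lt_one hq) hz N).tsum_eq) hlim'
  rw [tsum_mul_right] at heq
  convert hsum.hasSum using 1
  rw [qPochInf3, ← div_left_inj' (mul_ne_zero hne hne), div_eq_mul_inv (tsum _), mul_inv, heq]
  field_simp

/-! ### The weak Bailey lemma -/

theorem summable_weak_bailey {q : ℂ} (hq : ‖q‖ < 1) {ι : Type*} {w : ι → ℂ} (hw : Summable w)
    (m : ι → ℤ) :
    Summable fun p : ℕ × ι =>
      q ^ p.1 ^ 2 * (w p.2 * (qPochRecip q (p.1 - m p.2) * qPochRecip q (p.1 + m p.2))) := by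
  obtain ⟨C, hC⟩ := exists_norm_qPochRecip_le hq
  have hC0 : 0 ≤ C := (norm_nonneg _).trans (hC 0)
  refine Summable.of_norm_bounded
    ((summable_geometric_of_lt_one (norm_nonneg q) hq).mul_of_nonneg (hw.norm.mul_right (C * C))
      (fun _ => by positivity) fun _ => by positivity) fun p => ?_
  have hpow : ‖q‖ ^ p.1 ^ 2 ≤ ‖q‖ ^ p.1 :=
    pow_le_pow_of_le_one (norm_nonneg q) hq.le (Nat.le_self_pow two_ne_zero _)
  rw [norm_mul, norm_mul, norm_mul, norm_pow]
  gcongr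
  exacts [hC _, hC _]

theorem hasSum_weak_bailey {q : ℂ} (hq : ‖q‖ < 1) {ι : Type*} {w : ι → ℂ} (hw : Summable w)
    (m : ι → ℤ) :
    HasSum
      (fun N : ℕ => q ^ N ^ 2 * ∑' i, w i * (qPochRecip q (N - m i) * qPochRecip q (N + m i)))
      ((∑' i, w i * q ^ m i ^ 2) * (qPochInf q q)⁻¹) := by
  let f (N : ℕ) (i : ι) : ℂ := q ^ N ^ 2 * (w i * (qPochRecip q (N - m i) * qPochRecip q (N + m i)))
  have hdouble : Summable (Function.uncurry f) := summable_weak_bailey hq hw m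
  have hcol (i : ι) : HasSum (f · i) (w i * (q ^ m i ^ 2 * (qPochInf q q)⁻¹)) :=
    ((hasSum_pow_sq_mul_qPochRecip hq (m i)).mul_left (w i)).congr_fun fun N =>
      mul_left_comm ..
  have hrows : HasSum (fun N => ∑' i, f N i) (∑' N, ∑' i, f N i) := hdouble.prod.hasSum
  rw [← hdouble.tsum_comm] at hrows
  simp only [(hcol _).tsum_eq, ← mul_assoc, tsum_mul_right] at hrows
  simpa only [f, tsum_mul_left] using hrows

theorem hasSum_pow_sq_mul_truncTheta {p q z : ℂ} (hp : p ≠ 0) (hp' : ‖p‖ < 1) (h0 : q ≠ 0)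
    (hq : ‖q‖ < 1) (hz : z ≠ 0) (s : ℤ) :
    HasSum (fun N : ℕ => q ^ N ^ 2 * truncTheta p q z (N - s) (N + s))
      (q ^ s ^ 2 * qPochInf3 (p * q ^ 8 / (q ^ (4 * s + 4) * z)) (q ^ (4 * s + 4) * z)
        (p * q ^ 8) (p * q ^ 8) / qPochInf q q) := by
  have hnorm : ‖p * q ^ 8‖ < 1 := by
    rw [norm_mul, norm_pow]
    exact mul_lt_one_of_nonneg_of_lt_one_left (norm_nonneg p) hp'
      (pow_le_one₀ (norm_nonneg q) hq.le)
  have hjacobi := hasSum_jacobi_triple_product (mul_ne_zero hp (pow_ne_zero 8 h0)) hnorm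
    (mul_ne_zero (zpow_ne_zero (4 * s + 4) h0) hz)
  have hterm (j : ℤ) : thetaTerm p z j * q ^ (s + 2 * j) ^ 2 =
      q ^ s ^ 2 * thetaTerm (p * q ^ 8) (q ^ (4 * s + 4) * z) j := by
    have hexp : (s + 2 * j) ^ 2 = s ^ 2 + (4 * s + 4) * j + 8 * (j * (j - 1) / 2) := by
      linear_combination -4 * two_mul_mul_sub_one_ediv_two j
    rw [thetaTerm_mul, thetaTerm, thetaTerm, mul_zpow, hexp, zpow_add₀ h0, zpow_add₀ h0, zpow_mul,
      zpow_mul q 8, zpow_ofNat]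
    ring
  have hbailey := hasSum_weak_bailey hq (summable_thetaTerm hp hp' hz) fun j => s + 2 * j
  simp only [hterm, tsum_mul_left, hjacobi.tsum_eq, ← div_eq_mul_inv] at hbailey
  simpa only [truncTheta, sub_add_eq_sub_sub, ← add_assoc] using hbailey

theorem hasSum_pow_sq_mul_cubicTheta {q : ℂ} (h0 : q ≠ 0) (hq : ‖q‖ < 1) (k s : ℤ) :
    HasSum (fun N : ℕ => q ^ N ^ 2 * cubicTheta q k (N - s) (N + s))
      (q ^ s ^ 2 * qPochInf3 (q ^ (7 - k - 4 * s)) (q ^ (4 + k + 4 * s)) (q ^ 11) (q ^ 11) /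
        qPochInf q q) := by
  have hcube : ‖q ^ 3‖ < 1 := by
    rw [norm_pow]
    exact pow_lt_one₀ (norm_nonneg q) hq three_ne_zero
  have h := hasSum_pow_sq_mul_truncTheta (pow_ne_zero 3 h0) hcube h0 hq (zpow_ne_zero k h0) s
  rwa [← pow_add, ← zpow_add₀ h0, ← zpow_natCast q (3 + 8), ← zpow_sub₀ h0, zpow_natCast,
    show ((3 + 8 : ℕ) : ℤ) - (4 * s + 4 + k) = 7 - k - 4 * s by push_cast; ring,
    show 4 * s + 4 + k = 4 + k + 4 * s by ring] at h

theorem hasSum_cubicTheta_diag {q : ℂ} (h0 : q ≠ 0) (hq : ‖q‖ < 1) {k : ℤ} {i j : ℕ}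
    (hi : 7 - k = i) (hj : 4 + k = j) :
    HasSum (fun N : ℕ => q ^ N ^ 2 * cubicTheta q k N N)
      (qPochInf3 (q ^ i) (q ^ j) (q ^ 11) (q ^ 11) / qPochInf q q) := by
  simpa [hi, hj] using hasSum_pow_sq_mul_cubicTheta h0 hq k 0

theorem hasSum_cubicTheta_skew {q : ℂ} (h0 : q ≠ 0) (hq : ‖q‖ < 1) {k : ℤ} {i j : ℕ}
    (hi : 3 - k = i) (hj : 8 + k = j) :
    HasSum (fun N : ℕ => q ^ (N ^ 2 + 2 * N) * cubicTheta q k N (N + 2))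
      (qPochInf3 (q ^ i) (q ^ j) (q ^ 11) (q ^ 11) / qPochInf q q) := by
  have h := hasSum_pow_sq_mul_cubicTheta h0 hq k 1
  rw [← hasSum_nat_add_iff' 1, sum_range_one, Nat.cast_zero, zero_sub, zero_add,
    cubicTheta, truncTheta_neg_one_one, mul_zero, sub_zero, one_pow, zpow_one, mul_div_assoc,
    show 7 - k - 4 * 1 = i by linarith, show 4 + k + 4 * 1 = j by linarith, zpow_natCast,
    zpow_natCast] at h
  rw [← hasSum_mul_left_iff h0]
  refine h.congr_fun fun N => ?_
  rw [Nat.cast_succ, add_sub_cancel_right, add_assoc (N : ℤ), one_add_one_eq_two]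
  ring

/-! ### Double series -/

theorem hasSum_of_hasSum_antidiagonal {f : ℕ × ℕ → ℂ} {a : ℂ} (hf : Summable f)
    (h : HasSum (fun N => ∑ p ∈ antidiagonal N, f p) a) : HasSum f a := by
  have hsigma := (HasAntidiagonal.sigmaAntidiagonalEquivProd.hasSum_iff.mpr hf.hasSum).sigma
    fun N => hasSum_fintype _
  rw [h.unique (hsigma.congr_fun fun N => ?_)]
  · exact hf.hasSum
  · exact (sum_coe_sort _ f).symm

theorem hasSum_mul_qBinomSum {q : ℂ} (hq : ‖q‖ < 1) {c : ℕ → ℂ} {g : ℕ → ℕ → ℂ} {a : ℂ}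
    (hc : ∃ C, ∀ N, ‖c N‖ ≤ C * ‖q‖ ^ N) (hg : ∃ G, ∀ n r, ‖g n r‖ ≤ G)
    (h : HasSum (fun N => c N * qBinomSum q g N) a) :
    HasSum (Function.uncurry fun n r => c (n + r) * (g n r / (qPoch q q n * qPoch q q r))) a := by
  obtain ⟨C, hC⟩ := hc
  obtain ⟨G, hG⟩ := hg
  obtain ⟨W, hW⟩ := exists_norm_qPochRecip_le hq
  have hC0 : 0 ≤ C := by simpa using (norm_nonneg _).trans (hC 0)
  have hG0 : 0 ≤ G := (norm_nonneg _).trans (hG 0 0)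
  have hW0 : 0 ≤ W := (norm_nonneg _).trans (hW 0)
  have hgeom := summable_geometric_of_lt_one (norm_nonneg q) hq
  refine hasSum_of_hasSum_antidiagonal (Summable.of_norm_bounded
    ((hgeom.mul_of_nonneg hgeom (fun _ => by positivity) fun _ => by positivity).mul_left
      (C * (G * (W * W)))) fun p => ?_) (h.congr_fun fun N => ?_)
  · rw [Function.uncurry, div_eq_mul_inv, mul_inv, ← qPochRecip_natCast, ← qPochRecip_natCast,
      norm_mul, norm_mul, norm_mul, ← pow_add, mul_right_comm]
    gcongr
    exacts [hC _, hG _ _, hW _, hW _]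
  · rw [qBinomSum, mul_sum]
    refine sum_congr rfl fun p hp => ?_
    rw [Function.uncurry, mem_antidiagonal.mp hp]

theorem exists_norm_pow_mul_qPoch_div_le {q : ℂ} (hq : ‖q‖ < 1) {e : ℕ → ℕ} (he : ∀ N, N ≤ e N)
    (u v : ℕ → ℕ) :
    ∃ C, ∀ N, ‖q ^ e N * (qPoch q q (u N) / qPoch q q (v N))‖ ≤ C * ‖q‖ ^ N := by
  obtain ⟨V, hV⟩ := exists_norm_qPoch_le hq q
  obtain ⟨W, hW⟩ := exists_norm_qPochRecip_le hq
  have hV0 : 0 ≤ V := (norm_nonneg _).trans (hV 0)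
  refine ⟨V * W, fun N => ?_⟩
  have hpow : ‖q‖ ^ e N ≤ ‖q‖ ^ N := pow_le_pow_of_le_one (norm_nonneg q) hq.le (he N)
  rw [div_eq_mul_inv, ← qPochRecip_natCast, norm_mul, norm_mul, norm_pow, mul_comm]
  gcongr
  exacts [mul_nonneg hV0 ((norm_nonneg _).trans (hW 0)), hV _, hW _]

theorem exists_norm_comp_pow_mul_le {q : ℂ} (hq : ‖q‖ < 1) {P : ℂ → ℂ} (hP : Continuous P)
    (e : ℕ → ℕ → ℕ) : ∃ G, ∀ n r : ℕ, ‖P (q ^ n) * q ^ e n r‖ ≤ G := by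
  obtain ⟨G, hG⟩ := (Metric.isBounded_range_of_tendsto _ ((hP.tendsto 0).comp
    (tendsto_pow_atTop_nhds_zero_of_norm_lt_one hq))).exists_norm_le
  refine ⟨G, fun n r => ?_⟩
  rw [norm_mul, norm_pow]
  exact (mul_le_of_le_one_right (norm_nonneg _) (pow_le_one₀ (norm_nonneg q) hq.le)).trans
    (hG _ (Set.mem_range_self n))

theorem hasSum_double_of_hasSum_diag {q : ℂ} (hq : ‖q‖ < 1) {P : ℂ → ℂ} (hP : Continuous P)
    {T : ℕ → ℂ} {a : ℂ} (hT : HasSum (fun N => q ^ N ^ 2 * T N) a)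
    (h : ∀ N, T N = qPoch q q N / qPoch q q (2 * N) *
      qBinomSum q (fun n r => P (q ^ n) * (q ^ N) ^ r) N) :
    HasSum (Function.uncurry fun n r : ℕ =>
      q ^ (n ^ 2 + 2 * r ^ 2 + 3 * n * r) * qPoch q q (n + r) * P (q ^ n) /
        (qPoch q q (2 * n + 2 * r) * qPoch q q r * qPoch q q n)) a := by
  have hsum := hasSum_mul_qBinomSum hq
    (exists_norm_pow_mul_qPoch_div_le hq (fun N => Nat.le_self_pow two_ne_zero N) id (2 * ·))
    (exists_norm_comp_pow_mul_le hq hP fun n r => (n + r) * r) (hT.congr_fun fun N => ?_)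
  · refine hsum.congr_fun fun p => ?_
    simp only [Function.uncurry, id, div_eq_mul_inv, mul_inv, mul_add]
    ring
  · rw [h, mul_assoc]
    congr 2
    exact qBinomSum_congr q fun n r hnr => by rw [hnr, pow_mul]

theorem hasSum_double_of_hasSum_skew {q : ℂ} (hq : ‖q‖ < 1) {P : ℂ → ℂ} (hP : Continuous P)
    {T : ℕ → ℂ} {a : ℂ} (hT : HasSum (fun N => q ^ (N ^ 2 + 2 * N) * T N) a)
    (h : ∀ N, T N = qPoch q q (N + 1) / qPoch q q (2 * (N + 1)) *
      qBinomSum q (fun n r => P (q ^ n) * (q ^ (N + 1)) ^ r) N) :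
    HasSum (Function.uncurry fun n r : ℕ =>
      q ^ (n ^ 2 + 2 * r ^ 2 + 3 * n * r + 2 * n + 3 * r) * qPoch q q (n + r + 1) * P (q ^ n) /
        (qPoch q q (2 * n + 2 * r + 2) * qPoch q q r * qPoch q q n)) a := by
  have hsum := hasSum_mul_qBinomSum hq
    (exists_norm_pow_mul_qPoch_div_le hq (e := fun N => N ^ 2 + 2 * N) (fun N => by nlinarith)
      (· + 1) fun N => 2 * (N + 1))
    (exists_norm_comp_pow_mul_le hq hP fun n r => (n + r + 1) * r) (hT.congr_fun fun N => ?_)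
  · refine hsum.congr_fun fun p => ?_
    simp only [Function.uncurry, div_eq_mul_inv, mul_inv, mul_add, mul_one]
    ring
  · rw [h, mul_assoc]
    congr 2
    exact qBinomSum_congr q fun n r hnr => by rw [hnr, pow_mul]

theorem hasSum_double_zero {e : ℕ → ℕ → ℕ} (he₀ : e 0 0 = 0) (he : ∀ n r, n + r ≤ e n r)
    (u v : ℕ → ℕ → ℕ) (A : ℕ → ℂ) :
    HasSum (Function.uncurry fun n r : ℕ => 0 ^ e n r * qPoch 0 0 (u n r) * A n /
      (qPoch 0 0 (v n r) * qPoch 0 0 r * qPoch 0 0 n)) (A 0) := by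
  have hqPoch (m : ℕ) : qPoch 0 0 m = 1 := by simp [qPoch]
  simp only [hqPoch, mul_one, div_one]
  convert hasSum_single ((0, 0) : ℕ × ℕ) fun p hp => ?_ using 1
  · simp [he₀]
  · have hpos : e p.1 p.2 ≠ 0 := fun h => hp <| Prod.ext
      (by have := he p.1 p.2; omega) (by have := he p.1 p.2; omega)
    rw [Function.uncurry, zero_pow hpos, zero_mul]

theorem hasSum_double_diag_zero (A : ℕ → ℂ) :
    HasSum (Function.uncurry fun n r : ℕ =>
      0 ^ (n ^ 2 + 2 * r ^ 2 + 3 * n * r) * qPoch 0 0 (n + r) * A n /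
        (qPoch 0 0 (2 * n + 2 * r) * qPoch 0 0 r * qPoch 0 0 n)) (A 0) :=
  hasSum_double_zero (e := fun n r => n ^ 2 + 2 * r ^ 2 + 3 * n * r) rfl
    (fun n r => by nlinarith [Nat.le_self_pow two_ne_zero n, Nat.le_self_pow two_ne_zero r])
    (fun n r => n + r) (fun n r => 2 * n + 2 * r) A

theorem hasSum_double_skew_zero (A : ℕ → ℂ) :
    HasSum (Function.uncurry fun n r : ℕ =>
      0 ^ (n ^ 2 + 2 * r ^ 2 + 3 * n * r + 2 * n + 3 * r) * qPoch 0 0 (n + r + 1) * A n /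
        (qPoch 0 0 (2 * n + 2 * r + 2) * qPoch 0 0 r * qPoch 0 0 n)) (A 0) :=
  hasSum_double_zero (e := fun n r => n ^ 2 + 2 * r ^ 2 + 3 * n * r + 2 * n + 3 * r) rfl
    (fun n r => by nlinarith [Nat.zero_le (n * r)]) (fun n r => n + r + 1)
    (fun n r => 2 * n + 2 * r + 2) A

theorem qPochInf3_zero_div : qPochInf3 0 0 0 0 / qPochInf 0 0 = 1 := by
  simp [qPochInf3, qPochInf]

theorem mainTheorem9 (q : ℂ) (hq : ‖q‖ < 1) :
    HasSum
      (Function.uncurry fun n r : ℕ =>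
        q ^ (n ^ 2 + 2 * r ^ 2 + 3 * n * r + 2 * n + 3 * r) * qPoch q q (n + r + 1) /
          (qPoch q q (2 * n + 2 * r + 2) * qPoch q q r * qPoch q q n))
      (qPochInf3 q (q ^ 10) (q ^ 11) (q ^ 11) / qPochInf q q) ∧
    HasSum
      (Function.uncurry fun n r : ℕ =>
        q ^ (n ^ 2 + 2 * r ^ 2 + 3 * n * r + 2 * n + 3 * r) * qPoch q q (n + r + 1) *
            (1 + q ^ (n + 1) + q ^ n - q ^ (2 * n)) /
          (qPoch q q (2 * n + 2 * r + 2) * qPoch q q r * qPoch q q n))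
      (qPochInf3 (q ^ 2) (q ^ 9) (q ^ 11) (q ^ 11) / qPochInf q q) ∧
    (q ≠ 0 →
      HasSum
        (Function.uncurry fun n r : ℕ =>
          q ^ (n ^ 2 + 2 * r ^ 2 + 3 * n * r) * qPoch q q (n + r) *
              ((q ^ ((n : ℤ) - 1) + q ^ n - q ^ (2 * (n : ℤ) - 1)) -
                (q ^ (-1 : ℤ) + q ^ ((n : ℤ) - 2) + q ^ ((n : ℤ) - 1) - q ^ (2 * (n : ℤ) - 4)) *
                  (1 - q ^ ((n : ℤ) - 1)) * (1 - q ^ n)) /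
            (qPoch q q (2 * n + 2 * r) * qPoch q q r * qPoch q q n))
        (qPochInf3 (q ^ 3) (q ^ 8) (q ^ 11) (q ^ 11) / qPochInf q q)) ∧
    (q ≠ 0 →
      HasSum
        (Function.uncurry fun n r : ℕ =>
          q ^ (n ^ 2 + 2 * r ^ 2 + 3 * n * r) * qPoch q q (n + r) *
              (q ^ ((n : ℤ) - 1) + q ^ n - q ^ (2 * (n : ℤ) - 1)) /
            (qPoch q q (2 * n + 2 * r) * qPoch q q r * qPoch q q n))
        (qPochInf3 (q ^ 4) (q ^ 7) (q ^ 11) (q ^ 11) / qPochInf q q)) ∧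
    HasSum
      (Function.uncurry fun n r : ℕ =>
        q ^ (n ^ 2 + 2 * r ^ 2 + 3 * n * r) * qPoch q q (n + r) /
          (qPoch q q (2 * n + 2 * r) * qPoch q q r * qPoch q q n))
      (qPochInf3 (q ^ 5) (q ^ 6) (q ^ 11) (q ^ 11) / qPochInf q q) := by
  rcases eq_or_ne q 0 with rfl | h0
  · refine ⟨?_, ?_, fun h => absurd rfl h, fun h => absurd rfl h, ?_⟩
    · simpa [qPochInf3_zero_div] using hasSum_double_skew_zero 1
    · simpa [qPochInf3_zero_div] using
        hasSum_double_skew_zero fun n => 1 + 0 ^ (n + 1) + 0 ^ n - 0 ^ (2 * n)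
    · simpa [qPochInf3_zero_div] using hasSum_double_diag_zero 1
  have hq' := not_isOfFinOrder_of_norm_lt_one hq
  refine ⟨?_, ?_, fun _ => ?_, fun _ => ?_, ?_⟩
  · simpa only [Pi.one_apply, mul_one, pow_one] using
      hasSum_double_of_hasSum_skew hq (P := 1) continuous_one
      (hasSum_cubicTheta_skew h0 hq (k := 2) (i := 1) (j := 10) rfl rfl)
      (by simpa [rogersSzego] using cubicTheta_two_skew_eq hq' h0)
  · convert hasSum_double_of_hasSum_skew hq (P := fun x => 1 + q * x + x - x ^ 2) (by fun_prop)
      (hasSum_cubicTheta_skew h0 hq (k := 1) rfl rfl) (cubicTheta_one_skew_eq hq' h0) using 6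
    rw [pow_succ', pow_mul']
  · simp only [zpow_sub₀ h0, zpow_mul', zpow_neg_one, zpow_natCast, zpow_ofNat, pow_one]
    exact hasSum_double_of_hasSum_diag hq (P := fun x => (x / q + x - x ^ 2 / q) -
      (q⁻¹ + x / q ^ 2 + x / q - x ^ 2 / q ^ 4) * (1 - x / q) * (1 - x)) (by fun_prop)
      (hasSum_cubicTheta_diag h0 hq (k := 4) rfl rfl) (cubicTheta_four_eq hq' h0)
  · simp only [zpow_sub₀ h0, zpow_mul', zpow_natCast, zpow_ofNat, pow_one]
    exact hasSum_double_of_hasSum_diag hq (P := fun x => x / q + x - x ^ 2 / q) (by fun_prop)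
      (hasSum_cubicTheta_diag h0 hq (k := 3) rfl rfl) (cubicTheta_three_eq hq' h0)
  · simpa only [Pi.one_apply, mul_one] using hasSum_double_of_hasSum_diag hq (P := 1) continuous_one
      (hasSum_cubicTheta_diag h0 hq (k := 2) rfl rfl)
      (by simpa [rogersSzego] using fun N => (cubicTheta_two_eq_rogersSzego hq' h0 N).1)
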